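/- Let $H$ be a complex Hilbert space and let $\mathcal L$ be a commutative subspace lattice (CSL) on $H$, that is, a collection of closed subspaces of $H$ which contains $(0)$ and $H$, contains the intersection and the closed linear span of each of its subfamilies, and whose orthogonal projections commute pairwise. Let $\mathrm{alg}\,\mathcal L$ be the algebra of all bounded linear operators on $H$ that leave every member of $\mathcal L$ invariant. Let $f:\mathrm{alg}\,\mathcal L\to\mathrm{alg}\,\mathcal L$ be a linear map (not assumed continuous) that is a generalized Jordan derivation, i.e. there is a linear map $d:\mathrm{alg}\,\mathcal L\to\mathrm{alg}\,\mathcal L$ with $d(A^2)=d(A)A+A\,d(A)$ and $$f(A^2)=f(A)A+A\,d(A)\qquad\text{for all }A\in\mathrm{alg}\,\mathcal L .$$ Then $f$ is a generalized derivation, i.e. there is a linear map $d':\mathrm{alg}\,\mathcal L\to\mathrm{alg}\,\mathcal L$ with $d'(AB)=d'(A)B+A\,d'(B)$ and $$f(AB)=f(A)B+A\,d'(B)\qquad\text{for all }A,B\in\mathrm{alg}\,\mathcal L .$$ -/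

import Mathlib

/-- A subspace lattice on `H`: a collection of closed subspaces containing `(0)` and `H` and
containing the intersection and the closed linear span of each of its subfamilies. (In
`ClosedSubmodule ℂ H`, `sInf` is the intersection and `sSup` is the closed linear span.) -/
structure IsSubspaceLattice {H : Type*} [NormedAddCommGroup H] [InnerProductSpace ℂ H]
    (L : Set (ClosedSubmodule ℂ H)) : Prop where
  bot_mem : ⊥ ∈ L
  top_mem : ⊤ ∈ L
  sInf_mem : ∀ S ⊆ L, sInf S ∈ L
  sSup_mem : ∀ S ⊆ L, sSup S ∈ L

/-- A commutative subspace lattice (CSL): a subspace lattice whose orthogonal projections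
commute pairwise. -/
structure IsCSL {H : Type*} [NormedAddCommGroup H] [InnerProductSpace ℂ H] [CompleteSpace H]
    (L : Set (ClosedSubmodule ℂ H)) : Prop extends IsSubspaceLattice L where
  commute : ∀ E ∈ L, ∀ F ∈ L,
    Commute E.toSubmodule.starProjection F.toSubmodule.starProjection

/-- `alg L`: the algebra of all bounded operators on `H` that leave every member of `L`
invariant. -/
def algLat {H : Type*} [NormedAddCommGroup H] [InnerProductSpace ℂ H]
    (L : Set (ClosedSubmodule ℂ H)) : Subalgebra ℂ (H →L[ℂ] H) where
  carrier := {A | ∀ E ∈ L, ∀ x ∈ E, A x ∈ E}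
  mul_mem' := fun hA hB E hE x hx => hA E hE _ (hB E hE x hx)
  add_mem' := fun hA hB E hE x hx => E.toSubmodule.add_mem (hA E hE x hx) (hB E hE x hx)
  algebraMap_mem' := fun c E _ x hx => E.toSubmodule.smul_mem c hx

/-- A linear map `d` of an algebra into itself is a derivation. -/
def IsDerivation {R A : Type*} [CommRing R] [Ring A] [Algebra R A] (d : A →ₗ[R] A) : Prop :=
  ∀ a b : A, d (a * b) = d a * b + a * d b

/-- A linear map `d` of an algebra into itself is a Jordan derivation. -/
def IsJordanDerivation {R A : Type*} [CommRing R] [Ring A] [Algebra R A] (d : A →ₗ[R] A) :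
    Prop :=
  ∀ a : A, d (a * a) = d a * a + a * d a

/-- A linear map `f` of an algebra into itself is a generalized derivation: it satisfies
`f (ab) = f(a) b + a d(b)` for some derivation `d`. -/
def IsGeneralizedDerivation {R A : Type*} [CommRing R] [Ring A] [Algebra R A]
    (f : A →ₗ[R] A) : Prop :=
  ∃ d : A →ₗ[R] A, IsDerivation d ∧ ∀ a b : A, f (a * b) = f a * b + a * d b

/-- A linear map `f` of an algebra into itself is a generalized Jordan derivation: it satisfies
`f (a²) = f(a) a + a d(a)` for some Jordan derivation `d`. -/
def IsGeneralizedJordanDerivation {R A : Type*} [CommRing R] [Ring A] [Algebra R A]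
    (f : A →ₗ[R] A) : Prop :=
  ∃ d : A →ₗ[R] A, IsJordanDerivation d ∧ ∀ a : A, f (a * a) = f a * a + a * d a

/-! Replacing `a` by `a + 1` gives `f a = f 1 * a + d a`, so it suffices that every Jordan
derivation `d` of `alg L` is a derivation. In a 2-torsion-free semiprime ring this is Herstein's
theorem. `alg L` need not be semiprime, but the argument needs semiprimeness only for elements of an
ideal containing all Leibniz defects (`isDerivation_of_leibnizDefect_mem`). Such an ideal comes from
the projections `p` onto members of `L`: they lie in `alg L` because they commute, and `(1 - p) * x
* p = 0`. Peirce computations (`leibnizDefect_of_triangular`) show that a defect commutes with each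
`p` and annihilates the corners `p * x * (1 - p)`; such elements form an ideal. If `t` is in it,
`star t` also commutes with every `p`, hence lies in `alg L`, and `t * star t * t = 0` forces `t =
0`. -/

section JordanDerivation

variable {R A : Type*} [CommRing R] [Ring A] [Algebra R A]

/-- The failure of the Leibniz rule for a linear map. -/
def leibnizDefect (d : A →ₗ[R] A) (a b : A) : A := d (a * b) - d a * b - a * d b

theorem leibnizDefect_add_left (d : A →ₗ[R] A) (a a' b : A) :
    leibnizDefect d (a + a') b = leibnizDefect d a b + leibnizDefect d a' b := by
  simp only [leibnizDefect, add_mul, map_add]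
  abel

theorem leibnizDefect_add_right (d : A →ₗ[R] A) (a b b' : A) :
    leibnizDefect d a (b + b') = leibnizDefect d a b + leibnizDefect d a b' := by
  simp only [leibnizDefect, mul_add, map_add]
  abel

namespace IsJordanDerivation

variable {d : A →ₗ[R] A}

theorem map_mul_add_mul (hd : IsJordanDerivation d) (a b : A) :
    d (a * b + b * a) = d a * b + a * d b + d b * a + b * d a := by
  have h := hd (a + b)
  have e : (a + b) * (a + b) = a * a + (a * b + b * a) + b * b := by noncomm_ring
  rw [e, map_add, map_add, hd a, hd b, map_add d a b] at h
  linear_combination (norm := noncomm_ring) h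

theorem map_one (hd : IsJordanDerivation d) : d 1 = 0 := by
  have h := hd 1
  simpa using h

theorem leibnizDefect_swap (hd : IsJordanDerivation d) (a b : A) :
    leibnizDefect d b a = -leibnizDefect d a b := by
  have h := hd.map_mul_add_mul a b
  rw [map_add] at h
  simp only [leibnizDefect]
  linear_combination (norm := noncomm_ring) h

theorem map_mul_mul_self (hd : IsJordanDerivation d) (h2 : ∀ a : A, a + a = 0 → a = 0) (a b : A) :
    d (a * b * a) = d a * b * a + a * d b * a + a * b * d a := by
  have h := hd.map_mul_add_mul a (a * b + b * a)
  have h' := hd.map_mul_add_mul (a * a) b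
  have e : a * (a * b + b * a) + (a * b + b * a) * a
      = (a * a * b + b * (a * a)) + (a * b * a + a * b * a) := by noncomm_ring
  rw [e, map_add, h', hd.map_mul_add_mul a b, hd a, map_add] at h
  apply sub_eq_zero.1
  apply h2
  linear_combination (norm := noncomm_ring) h

theorem map_mul_mul_add (hd : IsJordanDerivation d) (h2 : ∀ a : A, a + a = 0 → a = 0)
    (a b c : A) :
    d (a * b * c + c * b * a) = d a * b * c + a * d b * c + a * b * d c +
      (d c * b * a + c * d b * a + c * b * d a) := by
  have h := hd.map_mul_mul_self h2 (a + c) b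
  have e : (a + c) * b * (a + c) = a * b * a + (a * b * c + c * b * a) + c * b * c := by
    noncomm_ring
  rw [e, map_add, map_add, hd.map_mul_mul_self h2 a, hd.map_mul_mul_self h2 c, map_add d a c] at h
  linear_combination (norm := noncomm_ring) h

/-- Compares two expansions of `d (abxba + baxab)`: as a triple product in `ab`, `x`, `ba`, and as
`a(bxb)a + b(axa)b`. -/
theorem leibnizDefect_mul_commutator (hd : IsJordanDerivation d)
    (h2 : ∀ a : A, a + a = 0 → a = 0) (a b x : A) :
    leibnizDefect d a b * x * (a * b - b * a) + (a * b - b * a) * x * leibnizDefect d a b = 0 := by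
  have h := hd.map_mul_mul_add h2 (a * b) x (b * a)
  have e : a * b * x * (b * a) + b * a * x * (a * b)
      = a * (b * x * b) * a + b * (a * x * a) * b := by noncomm_ring
  rw [e, map_add, hd.map_mul_mul_self h2 a, hd.map_mul_mul_self h2 b x,
    hd.map_mul_mul_self h2 b, hd.map_mul_mul_self h2 a x] at h
  have hs : d (b * a) = d a * b + a * d b + d b * a + b * d a - d (a * b) := by
    rw [← hd.map_mul_add_mul, map_add, add_sub_cancel_left]
  rw [hs] at h
  simp only [leibnizDefect]
  linear_combination (norm := noncomm_ring) h

/-! ### Peirce decomposition at a triangular idempotent -/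

section Peirce

variable {p : A}

/-- The off-diagonal vanishing of the Leibniz defect at a triangular idempotent killed by `d`. -/
theorem leibnizDefect_of_map_eq_zero (hd : IsJordanDerivation d)
    (h2 : ∀ a : A, a + a = 0 → a = 0) (hp : p * p = p) (htri : ∀ x, (1 - p) * x * p = 0)
    (hdp : d p = 0) (a b : A) :
    p * leibnizDefect d a b * (1 - p) = 0 ∧
      (∀ x, leibnizDefect d a b * (p * x * (1 - p)) = 0) ∧
      ∀ x, (p * x * (1 - p)) * leibnizDefect d a b = 0 := by
  obtain ⟨q, hq⟩ : ∃ q, q = 1 - p := ⟨_, rfl⟩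
  rw [← hq] at htri ⊢
  have hpq : p + q = 1 := by rw [hq]; abel
  have hpq0 : p * q = 0 := by rw [hq, mul_sub, mul_one, hp, sub_self]
  have hqp0 : q * p = 0 := by rw [hq, sub_mul, one_mul, hp, sub_self]
  have hqq : q * q = q := by
    calc q * q = (p + q) * q := by rw [add_mul, hpq0, zero_add]
      _ = q := by rw [hpq, one_mul]
  have hdq : d q = 0 := by rw [hq, map_sub, hd.map_one, hdp, sub_zero]
  have d11 : ∀ x, d (p * x * p) = p * d x * p := fun x => by
    rw [hd.map_mul_mul_self h2, hdp]; simp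
  have d22 : ∀ x, d (q * x * q) = q * d x * q := fun x => by
    rw [hd.map_mul_mul_self h2, hdq]; simp
  have d12 : ∀ x, d (p * x * q) = p * d x * q := fun x => by
    have h := hd.map_mul_mul_add h2 p x q
    rw [htri, hdp, hdq, add_zero, htri] at h
    simpa using h
  have hxp : ∀ x, x * p = p * x * p := fun x => by
    calc x * p = (p + q) * x * p := by rw [hpq, one_mul]
      _ = p * x * p := by rw [add_mul, add_mul, htri, add_zero]
  have hqx : ∀ x, q * x = q * x * q := fun x => by
    calc q * x = q * x * (p + q) := by rw [hpq, mul_one]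
      _ = q * x * q := by rw [mul_add, htri, zero_add]
  -- A corner element times `p * a * p` vanishes in one order, so the Jordan product is an ordinary
  -- product and the Leibniz rule becomes one-sided.
  have left : ∀ a x, d (a * (p * x * q)) = d a * (p * x * q) + a * d (p * x * q) := fun a x => by
    have h := hd.map_mul_add_mul (p * a * p) (p * x * q)
    have e1 : ∀ u v, (p * u * q) * (p * v * p) = 0 := fun u v => by
      simp only [mul_assoc]; rw [← mul_assoc q p, hqp0]; simp
    have e2 : ∀ u v, (p * u * p) * (p * v * q) = u * (p * v * q) := fun u v => by
      rw [← hxp]; simp only [mul_assoc]; rw [← mul_assoc p p, hp]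
    rw [e1, d11, d12, e1, e1, e2, e2, e2, add_zero, add_zero, add_zero] at h
    rw [h, d12]
  have right : ∀ a x, d ((p * x * q) * a) = d (p * x * q) * a + (p * x * q) * d a := fun a x => by
    have h := hd.map_mul_add_mul (p * x * q) (q * a * q)
    have e1 : ∀ u v, (q * v * q) * (p * u * q) = 0 := fun u v => by
      simp only [mul_assoc]; rw [← mul_assoc q p, hqp0]; simp
    have e2 : ∀ u v, (p * v * q) * (q * u * q) = (p * v * q) * u := fun u v => by
      rw [← hqx]; simp only [mul_assoc]; rw [← mul_assoc q q, hqq]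
    rw [e1, d22, d12, e1, e1, e2, e2, e2, add_zero, add_zero, add_zero] at h
    rw [h, d12]
  refine ⟨?_, fun x => ?_, fun x => ?_⟩
  · have h1 : p * (a * b) * q = a * (p * b * q) + (p * a * q) * b := by
      calc p * (a * b) * q = p * a * (p + q) * b * q := by rw [hpq]; noncomm_ring
        _ = (p * a * p) * (b * q) + p * a * (q * b * q) := by noncomm_ring
        _ = _ := by rw [← hxp, ← hqx]; noncomm_ring
    have h3 := d12 (a * b)
    rw [h1, map_add, left, right, d12, d12] at h3
    have e1 : p * (d a * b) * q = d a * (p * b * q) + (p * d a * q) * b := by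
      calc p * (d a * b) * q = p * d a * (p + q) * b * q := by rw [hpq]; noncomm_ring
        _ = (p * d a * p) * (b * q) + p * d a * (q * b * q) := by noncomm_ring
        _ = _ := by rw [← hxp, ← hqx]; noncomm_ring
    have e2 : p * (a * d b) * q = a * (p * d b * q) + (p * a * q) * d b := by
      calc p * (a * d b) * q = p * a * (p + q) * d b * q := by rw [hpq]; noncomm_ring
        _ = (p * a * p) * (d b * q) + p * a * (q * d b * q) := by noncomm_ring
        _ = _ := by rw [← hxp, ← hqx]; noncomm_ring
    simp only [leibnizDefect, mul_sub, sub_mul]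
    rw [← h3, e1, e2]
    abel
  -- Expand `d` of `a * b * (p * x * q)` with both bracketings; `b * (p * x * q)` is again in the
  -- corner.
  · have h1 := left (a * b) x
    have h3 := left b x
    have e : b * (p * x * q) = p * (b * p * x) * q := by
      calc b * (p * x * q) = (b * p) * x * q := by noncomm_ring
        _ = (p * b * p) * x * q := by rw [← hxp]
        _ = _ := by noncomm_ring
    have h4 := left a (b * p * x)
    rw [← e, h3, ← mul_assoc, h1] at h4
    simp only [leibnizDefect]
    linear_combination (norm := noncomm_ring) h4
  · have h1 := right (a * b) x
    have h3 := right a x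
    have e : (p * x * q) * a = p * (x * q * a) * q := by
      calc (p * x * q) * a = p * x * (q * a) := by noncomm_ring
        _ = p * x * (q * a * q) := by rw [← hqx]
        _ = _ := by noncomm_ring
    have h4 := right b (x * q * a)
    rw [← e, h3, mul_assoc, h1] at h4
    simp only [leibnizDefect]
    linear_combination (norm := noncomm_ring) h4

theorem sub_inner (hd : IsJordanDerivation d) (t : A) :
    IsJordanDerivation (d - (LinearMap.mulRight R t - LinearMap.mulLeft R t)) := by
  intro a
  simp only [LinearMap.sub_apply, LinearMap.mulRight_apply, LinearMap.mulLeft_apply, hd a]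
  noncomm_ring

/-- At a triangular idempotent, the Leibniz defect of a Jordan derivation commutes with the
idempotent and annihilates the off-diagonal corner on both sides. -/
theorem leibnizDefect_of_triangular (hd : IsJordanDerivation d)
    (h2 : ∀ a : A, a + a = 0 → a = 0) (hp : p * p = p) (htri : ∀ x, (1 - p) * x * p = 0)
    (a b : A) :
    leibnizDefect d a b * p = p * leibnizDefect d a b ∧
      (∀ x, leibnizDefect d a b * (p * x * (1 - p)) = 0) ∧
      ∀ x, (p * x * (1 - p)) * leibnizDefect d a b = 0 := by
  have hdp := hd p
  rw [hp] at hdp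
  have hxp : ∀ x, x * p = p * x * p := fun x => by
    have := htri x
    rw [sub_mul, sub_mul, one_mul, sub_eq_zero] at this
    exact this
  have hpdp : d p * p = 0 := by
    have h := congrArg (fun x => p * x) hdp
    simp only [mul_add, ← mul_assoc, hp] at h
    rw [hxp]
    exact left_eq_add.1 (h.trans (add_comm _ _))
  -- The inner derivation `x ↦ x * d p - d p * x` sends `p` to `d p`, since `d p * p = 0`;
  -- subtracting it kills `p` and leaves the defect unchanged.
  have key := (hd.sub_inner (d p)).leibnizDefect_of_map_eq_zero h2 hp htri
    (by simp only [LinearMap.sub_apply, LinearMap.mulRight_apply, LinearMap.mulLeft_apply]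
        rw [hpdp, sub_zero, sub_eq_zero]
        rw [hpdp, zero_add] at hdp
        exact hdp) a b
  have e : leibnizDefect (d - (LinearMap.mulRight R (d p) - LinearMap.mulLeft R (d p))) a b
      = leibnizDefect d a b := by
    simp only [leibnizDefect, LinearMap.sub_apply, LinearMap.mulRight_apply,
      LinearMap.mulLeft_apply]
    noncomm_ring
  rw [e] at key
  refine ⟨?_, key.2⟩
  have h := key.1
  rw [mul_sub, mul_one, sub_eq_zero] at h
  rw [hxp, ← h]

end Peirce

/-! ### Herstein's argument relative to a semiprime ideal -/

/-- A Jordan derivation whose Leibniz defect takes values in a semiprime ideal is a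
derivation. -/
theorem isDerivation_of_leibnizDefect_mem (hd : IsJordanDerivation d)
    (h2 : ∀ a : A, a + a = 0 → a = 0) (I : TwoSidedIdeal A)
    (hI : ∀ t ∈ I, (∀ y, t * y * t = 0) → t = 0) (hmem : ∀ a b, leibnizDefect d a b ∈ I) :
    IsDerivation d := by
  have mulr : ∀ a b x, leibnizDefect d a b * x ∈ I := fun a b x => I.mul_mem_right _ _ (hmem a b)
  have flip : ∀ s c : A, s ∈ I → (∀ x, s * x * c = 0) → ∀ x, c * x * s = 0 := by
    intro s c hs h x
    refine hI _ (I.mul_mem_left _ _ hs) fun y => ?_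
    have := h y
    calc c * x * s * y * (c * x * s) = c * x * (s * y * c) * x * s := by noncomm_ring
      _ = 0 := by rw [this]; simp
  have diag : ∀ a b x, leibnizDefect d a b * x * (a * b - b * a) = 0 := by
    intro a b x
    have hsum := hd.leibnizDefect_mul_commutator h2 a b
    have hs := hmem a b
    revert hsum hs
    generalize leibnizDefect d a b = s
    generalize a * b - b * a = c
    intro hsum hs
    refine hI _ (I.mul_mem_right _ _ (I.mul_mem_right _ _ hs)) fun y => h2 _ ?_
    have e1 := hsum x
    have e2 := hsum (x * s * y)
    have e3 := hsum y
    -- `s * z * c = -(c * z * s)`; three such swaps turn `sxcysxc` into its own negative.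
    linear_combination (norm := noncomm_ring) s * x * e3 * x * c - e2 * x * c + e1 * y * s * x * c
  have left : ∀ a b v x, leibnizDefect d a b * x * (a * v - v * a) = 0 := by
    intro a b v x
    refine hI _ (by rw [mul_assoc]; exact mulr _ _ _) fun y => ?_
    -- Linearizing `diag` in `b` trades one factor of the square for one ending in `a * b - b * a`,
    -- which `flip` kills against the next defect.
    have e := diag a (b + v) x
    rw [leibnizDefect_add_right] at e
    have e1 := diag a b x
    have e2 := diag a v x
    have e3 := flip _ _ (hmem a b) (diag a b) y
    have e4 : leibnizDefect d a b * x * (a * v - v * a)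
        = -(leibnizDefect d a v * x * (a * b - b * a)) := by
      linear_combination (norm := noncomm_ring) e - e1 - e2
    linear_combination (norm := noncomm_ring)
      e4 * y * (leibnizDefect d a b * x * (a * v - v * a)) -
        leibnizDefect d a v * x * e3 * x * (a * v - v * a)
  have full : ∀ a b u v x, leibnizDefect d a b * x * (u * v - v * u) = 0 := by
    intro a b u v x
    refine hI _ (by rw [mul_assoc]; exact mulr _ _ _) fun y => ?_
    have e := left (a + u) b v x
    rw [leibnizDefect_add_left] at e
    have e1 := left a b v x
    have e2 := left u b v x
    have e3 := flip _ _ (hmem a b) (left a b v) y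
    have e4 : leibnizDefect d a b * x * (u * v - v * u)
        = -(leibnizDefect d u b * x * (a * v - v * a)) := by
      linear_combination (norm := noncomm_ring) e - e1 - e2
    linear_combination (norm := noncomm_ring)
      e4 * y * (leibnizDefect d a b * x * (u * v - v * u)) -
        leibnizDefect d u b * x * e3 * x * (u * v - v * u)
  intro a b
  suffices h : leibnizDefect d a b = 0 by
    simp only [leibnizDefect] at h
    linear_combination (norm := abel) h
  have hswap := hd.leibnizDefect_swap a b
  obtain ⟨s, hs⟩ : ∃ s, s = leibnizDefect d a b := ⟨_, rfl⟩
  have hsI : s ∈ I := hs ▸ hmem a b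
  have hfull : ∀ u v x, s * x * (u * v - v * u) = 0 := hs ▸ full a b
  have central : ∀ u, s * u = u * s := by
    intro u
    rw [← sub_eq_zero]
    refine hI _ (I.sub_mem (I.mul_mem_right _ _ hsI) (I.mul_mem_left _ _ hsI)) fun y => ?_
    have e1 := hfull s u (u * y)
    have e2 := hfull s u y
    linear_combination (norm := noncomm_ring) e1 - u * e2
  have sc : s * (a * b - b * a) = 0 := by simpa using hfull a b 1
  have cs : (a * b - b * a) * s = 0 := by rw [← central, sc]
  -- `d (ab - ba)` is `2s` plus the commutators of `d a, b` and `a, d b`, which `s` annihilates.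
  have hdc : s * d (a * b - b * a) = s * s + s * s := by
    have e1 := hfull (d a) b 1
    have e2 := hfull a (d b) 1
    rw [← hs] at hswap
    have hs' := hs
    rw [leibnizDefect] at hswap hs'
    rw [map_sub]
    linear_combination (norm := noncomm_ring) -(s * hs') - s * hswap + e1 + e2
  have pow : s * s * (s * s) = 0 := by
    -- Apply `d` to `sc + cs = 0` with `c = ab - ba`, then multiply by `s` on both sides: the `d s`
    -- terms vanish, leaving `4s⁴ = 0`.
    have h := hd.map_mul_add_mul s (a * b - b * a)
    rw [sc, cs, add_zero, map_zero, hdc, ← central (d _), hdc] at h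
    have e := congrArg (fun z => s * z * s) h
    apply h2
    apply h2
    linear_combination (norm := noncomm_ring) -e - s * d s * cs - sc * d s * s
  have sq : s * s = 0 := by
    refine hI _ (I.mul_mem_right _ _ hsI) fun y => ?_
    calc s * s * y * (s * s) = s * (s * y) * (s * s) := by noncomm_ring
      _ = s * (y * s) * (s * s) := by rw [central y]
      _ = (s * y) * s * (s * s) := by noncomm_ring
      _ = y * (s * s * (s * s)) := by rw [central y]; noncomm_ring
      _ = 0 := by rw [pow, mul_zero]
  rw [← hs]
  refine hI _ hsI fun y => ?_
  rw [central, mul_assoc, sq, mul_zero]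

end IsJordanDerivation

/-- A generalized Jordan derivation of a unital algebra differs from its associated Jordan
derivation by a left multiplication. -/
theorem IsGeneralizedJordanDerivation.isGeneralizedDerivation {f : A →ₗ[R] A}
    (hf : IsGeneralizedJordanDerivation f)
    (hA : ∀ d : A →ₗ[R] A, IsJordanDerivation d → IsDerivation d) :
    IsGeneralizedDerivation f := by
  obtain ⟨d, hd, hfd⟩ := hf
  have hder := hA d hd
  have key : ∀ a, f a = f 1 * a + d a := by
    intro a
    have h := hfd (a + 1)
    have e : (a + 1) * (a + 1) = a * a + a + a + 1 := by noncomm_ring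
    rw [e, map_add, map_add, map_add, hfd a, map_add f, map_add d, hd.map_one] at h
    linear_combination (norm := noncomm_ring) h
  refine ⟨d, hder, fun a b => ?_⟩
  rw [key (a * b), key a, hder]
  noncomm_ring

/-- The elements commuting with a family of triangular idempotents and annihilating all their
off-diagonal corners on both sides. -/
def offDiagonalAnnihilator (S : Set A) (htri : ∀ p ∈ S, ∀ x, (1 - p) * x * p = 0) :
    TwoSidedIdeal A :=
  .mk' {s | ∀ p ∈ S, s * p = p * s ∧ (∀ x, s * (p * x * (1 - p)) = 0) ∧
      ∀ x, (p * x * (1 - p)) * s = 0}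
    (fun p _ => by simp)
    (fun {s t} hs ht p hp => by
      obtain ⟨h1, h2, h3⟩ := hs p hp
      obtain ⟨k1, k2, k3⟩ := ht p hp
      refine ⟨by rw [add_mul, mul_add, h1, k1], fun x => ?_, fun x => ?_⟩
      · rw [add_mul, h2, k2, add_zero]
      · rw [mul_add, h3, k3, add_zero])
    (fun {s} hs p hp => by
      obtain ⟨h1, h2, h3⟩ := hs p hp
      refine ⟨by rw [neg_mul, mul_neg, h1], fun x => ?_, fun x => ?_⟩
      · rw [neg_mul, h2, neg_zero]
      · rw [mul_neg, h3, neg_zero])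
    (fun {y s} hs p hp => by
      obtain ⟨h1, h2, h3⟩ := hs p hp
      have t := htri p hp
      refine ⟨?_, fun x => by rw [mul_assoc, h2, mul_zero], fun x => ?_⟩
      -- Both `y * s * p` and `p * y * s` equal `p * y * p * s`: the first by triangularity, the
      -- second because `s` kills the corner.
      · linear_combination (norm := noncomm_ring) t y * s + y * h1 - h3 y
      · linear_combination (norm := noncomm_ring) h3 (x * (1 - p) * y) + p * x * t y * s)
    (fun {s y} hs p hp => by
      obtain ⟨h1, h2, h3⟩ := hs p hp
      have t := htri p hp
      refine ⟨?_, fun x => ?_, fun x => by rw [← mul_assoc, h3, zero_mul]⟩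
      · linear_combination (norm := noncomm_ring) s * t y - h2 y + h1 * y
      · linear_combination (norm := noncomm_ring) s * t y * x * (1 - p) + h2 (y * p * x))

theorem mem_offDiagonalAnnihilator {S : Set A} {htri : ∀ p ∈ S, ∀ x, (1 - p) * x * p = 0}
    {s : A} : s ∈ offDiagonalAnnihilator S htri ↔
      ∀ p ∈ S, s * p = p * s ∧ (∀ x, s * (p * x * (1 - p)) = 0) ∧
        ∀ x, (p * x * (1 - p)) * s = 0 :=
  TwoSidedIdeal.mem_mk' _ _ _ _ _ _ _

end JordanDerivation

/-! ### Application to the algebra of a CSL -/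

section CSL

variable {H : Type*} [NormedAddCommGroup H] [InnerProductSpace ℂ H] [CompleteSpace H]
  {L : Set (ClosedSubmodule ℂ H)}

theorem mem_algLat_of_commute {A : H →L[ℂ] H}
    (hA : ∀ E ∈ L, Commute A E.toSubmodule.starProjection) : A ∈ algLat L := by
  intro E hE x hx
  have h := DFunLike.congr_fun (hA E hE).eq x
  simp only [mul_apply_eq_comp] at h
  rw [Submodule.starProjection_eq_self_iff.2 hx] at h
  exact Submodule.starProjection_eq_self_iff.1 h.symm

/-- The orthogonal projections onto the members of a CSL, as elements of its algebra. -/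
def algLatProjections (L : Set (ClosedSubmodule ℂ H)) : Set (algLat L) :=
  {p | ∃ E ∈ L, (p : H →L[ℂ] H) = E.toSubmodule.starProjection}

theorem algLatProjections_mul_self {p : algLat L} (hp : p ∈ algLatProjections L) : p * p = p := by
  obtain ⟨E, -, h⟩ := hp
  ext1
  rw [MulMemClass.coe_mul, h]
  exact E.toSubmodule.isIdempotentElem_starProjection

theorem algLatProjections_triangular {p : algLat L} (hp : p ∈ algLatProjections L)
    (x : algLat L) : (1 - p) * x * p = 0 := by
  obtain ⟨E, hE, h⟩ := hp
  ext v
  have hv := x.2 E hE _ (E.toSubmodule.starProjection_apply_mem v)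
  have := Submodule.starProjection_eq_self_iff.2 hv
  simp [h, sub_mul, this]

theorem IsCSL.isDerivation (hL : IsCSL L) (d : algLat L →ₗ[ℂ] algLat L)
    (hd : IsJordanDerivation d) : IsDerivation d := by
  have h2 : ∀ a : algLat L, a + a = 0 → a = 0 := fun a ha => by
    rw [← two_smul ℂ] at ha
    exact (smul_eq_zero.1 ha).resolve_left two_ne_zero
  refine hd.isDerivation_of_leibnizDefect_mem h2
    (offDiagonalAnnihilator (algLatProjections L) fun _ => algLatProjections_triangular)
    (fun t ht hzero => ?_) fun a b => mem_offDiagonalAnnihilator.2 fun p hp =>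
      hd.leibnizDefect_of_triangular h2 (algLatProjections_mul_self hp)
        (algLatProjections_triangular hp) a b
  rw [mem_offDiagonalAnnihilator] at ht
  have hstar : star (t : H →L[ℂ] H) ∈ algLat L := by
    refine mem_algLat_of_commute fun E hE => ?_
    have hmem : E.toSubmodule.starProjection ∈ algLat L :=
      mem_algLat_of_commute fun F hF => hL.commute E hE F hF
    have h := congrArg Subtype.val (ht ⟨_, hmem⟩ ⟨E, hE, rfl⟩).1
    have h' := congrArg star h
    simp only [MulMemClass.coe_mul, star_mul] at h'
    rw [(isSelfAdjoint_starProjection E.toSubmodule).star_eq] at h'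
    exact h'.symm
  have h := congrArg Subtype.val (hzero ⟨_, hstar⟩)
  simp only [MulMemClass.coe_mul, ZeroMemClass.coe_zero] at h
  -- As `t * star t * t = 0`, the self-adjoint `star t * t` has square zero; the C*-identity, used
  -- twice, gives `t = 0`.
  have h' : star (star (t : H →L[ℂ] H) * t) * (star (t : H →L[ℂ] H) * t) = 0 := by
    rw [star_mul, star_star, mul_assoc, ← mul_assoc (t : H →L[ℂ] H), h, mul_zero]
  ext1
  exact CStarRing.star_mul_self_eq_zero_iff _ |>.1 (CStarRing.star_mul_self_eq_zero_iff _ |>.1 h')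

end CSL

theorem corollary2p3 {H : Type*} [NormedAddCommGroup H] [InnerProductSpace ℂ H]
    [CompleteSpace H] (L : Set (ClosedSubmodule ℂ H)) (hL : IsCSL L)
    (f : algLat L →ₗ[ℂ] algLat L) (hf : IsGeneralizedJordanDerivation f) :
    IsGeneralizedDerivation f :=
  hf.isGeneralizedDerivation hL.isDerivation
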